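/- **Definitions.** For a non-empty bounded set $S\subseteq\mathbb R^2$ let $\mathfrak l(S),\mathfrak r(S)$ be the infimum and supremum of the first coordinates of its points, $\mathfrak b(S),\mathfrak t(S)$ the infimum and supremum of the second coordinates, and $\mathrm{box}(S)=[\mathfrak l(S),\mathfrak r(S)]\times[\mathfrak b(S),\mathfrak t(S)]$. A *Pouna set* is a compact path-connected set $S\subseteq\mathbb R^2$ that is not an axis-parallel rectangle, i.e. not a product of two closed intervals (which may be degenerate). Its *territory* is $$\mathrm{Ter}(S)=\{(x,y)\in \mathrm{box}(S)\setminus S:\ \exists x'>x,\ (x',y)\in S\},$$ and $S$ is *strong* if $\mathrm{Ter}(S)\neq\varnothing$. For strong Pouna sets $A,B$ write $A\prec B$ if $\mathrm{box}(A)\subseteq \mathrm{Ter}(B)$, and $A\curvearrowright B$ if $A\ne B$, $A\cap B\neq\varnothing$, $\mathfrak l(B)\le\mathfrak l(A)<\mathfrak r(B)<\mathfrak r(A)$, $\mathfrak b(B)<\mathfrak b(A)<\mathfrak t(A)<\mathfrak t(B)$ and $\{(x,y)\in A: x=\mathfrak l(A)\}\subseteq \mathrm{Ter}(B)$. A *constrained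 family* is a non-empty finite family $\mathcal F$ of strong Pouna sets such that - (C1) for all $A,B\in\mathcal F$ with $A\neq B$ and $A\cap B\ne\varnothing$, either $A\curvearrowright B$ or $B\curvearrowright A$; - (C2) for all $A,B\in\mathcal F$ with $A\cap B=\varnothing$ and $A\cap \mathrm{Ter}(B)\neq\varnothing$, we have $A\prec B$; - (C3) for all $A,B\in\mathcal F$ with $A\ne B$ and $A\cap B\neq\varnothing$, there is no $C\in\mathcal F$ with $C\subseteq \mathrm{Ter}(A)\cap \mathrm{Ter}(B)$; - (C4) there are no $A,B,C\in\mathcal F$ with $A\prec B$, $A\curvearrowright C$ and $B\curvearrowright C$; - (C5) at most two distinct elements of $\mathcal F$ can be pairwise intersecting. The *oriented intersection graph* of $\mathcal F$ has vertex set $\mathcal F$ and an arc from $A$ to $B$ whenever $A\curvearrowright B$. An *oriented constrained graph* is an oriented graph isomorphic to the oriented intersection graph of a constrained family. A *Burling set* is a triple $(S,\prec,\curvearrowright)$ where $S$ is a non-empty set, $\prec$ is a strict partial order on $S$, $\curvearrowright$ is a binary relation on $S$ without directed cycles (of any length $\geq 1$), and for all $x,y,z\in S$: - (A1) if $x\prec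 y$, $x\prec z$ and $y\neq z$, then $y\prec z$ or $z\prec y$; - (A2) if $x\curvearrowright y$, $x\curvearrowright z$ and $y\ne z$, then $y\prec z$ or $z\prec y$; - (A3) if $x\curvearrowright y$ and $x\prec z$, then $y\prec z$; - (A4) if $x\curvearrowright y$ and $y\prec z$, then $x\curvearrowright z$ or $x\prec z$. An *oriented abstract Burling graph* is an oriented graph $G$ for which some strict partial order $\prec$ on $V(G)$ makes $(V(G),\prec,A(G))$ a Burling set. The *oriented Burling sequence* $(G_k,\mathcal S_k)_{k\ge 1}$ consists of oriented graphs $G_k$ with sets $\mathcal S_k$ of subsets of $V(G_k)$. $G_1$ has a single vertex and $\mathcal S_1=\{V(G_1)\}$. $G_{k+1}$ is obtained from a (base) copy of $G_k$ by adding, for each $S\in\mathcal S_k$, a new disjoint copy $G_k^S$ of $G_k$ and, for all $S,Q\in\mathcal S_k$, a new vertex $v_{S,Q}$ with an arc to each vertex of $Q^S$ (the copy of $Q$ in $G_k^S$) and no other arcs. $\mathcal S_{k+1}$ consists of all the sets $S\cup Q^S$ and $S\cup\{v_{S,Q}\}$ with $S,Q\in\mathcal S_k$, where $S$ is taken in the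 base copy. An *oriented Burling graph* is an oriented graph isomorphic to an induced subgraph of some $G_k$. A *Burling graph* is a (non-oriented) graph isomorphic to an induced subgraph of the underlying graph of some $G_k$. **Theorem.** For every constrained family $\mathcal F$, the triple $(\mathcal F,\prec,\curvearrowright)$ is a Burling set. Every oriented constrained graph is an oriented abstract Burling graph, and therefore a Burling graph: it is an oriented Burling graph, and its underlying graph is a Burling graph. -/

import Mathlib

/-! ### Bounding boxes of plane sets -/

noncomputable section

/-- The infimum of the first coordinates of the points of `S`. -/
def leftEnd (S : Set (ℝ × ℝ)) : ℝ := sInf (Prod.fst '' S)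

/-- The supremum of the first coordinates of the points of `S`. -/
def rightEnd (S : Set (ℝ × ℝ)) : ℝ := sSup (Prod.fst '' S)

/-- The infimum of the second coordinates of the points of `S`. -/
def bottomEnd (S : Set (ℝ × ℝ)) : ℝ := sInf (Prod.snd '' S)

/-- The supremum of the second coordinates of the points of `S`. -/
def topEnd (S : Set (ℝ × ℝ)) : ℝ := sSup (Prod.snd '' S)

end

/-- The bounding box of a (non-empty, bounded) plane set: the smallest closed axis-parallel rectangle
containing it. -/
def boundingBox (S : Set (ℝ × ℝ)) : Set (ℝ × ℝ) :=
  Set.Icc (leftEnd S) (rightEnd S) ×ˢ Set.Icc (bottomEnd S) (topEnd S)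

/-- Axis-parallel rectangles: products of two closed bounded intervals. The intervals may be empty or
reduced to one point, so the empty set, points and axis-parallel segments are included. (Unbounded
closed intervals play no role, since only compact sets are compared with rectangles.) -/
def IsAxisParallelRectangle (S : Set (ℝ × ℝ)) : Prop :=
  ∃ a b c d : ℝ, S = Set.Icc a b ×ˢ Set.Icc c d

/-! ### Pouna sets, territories, and the relations `≺` and `↷` -/

/-- A Pouna set: compact, path-connected, and not an axis-parallel rectangle. -/
structure IsPounaSet (S : Set (ℝ × ℝ)) : Prop where
  isPathConnected : IsPathConnected S
  isCompact : IsCompact S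
  not_rectangle : ¬ IsAxisParallelRectangle S

/-- The territory of `S`: the points of the bounding box outside `S` which have a point of `S`
strictly to their right on the same horizontal line. -/
def territory (S : Set (ℝ × ℝ)) : Set (ℝ × ℝ) :=
  {p | p ∈ boundingBox S \ S ∧ ∃ x' : ℝ, p.1 < x' ∧ (x', p.2) ∈ S}

/-- A strong Pouna set: one with non-empty territory. -/
def IsStrongPounaSet (S : Set (ℝ × ℝ)) : Prop :=
  IsPounaSet S ∧ (territory S).Nonempty

/-- `A ≺ B`: the bounding box of `A` lies in the territory of `B`. -/
def PounaPrec (A B : Set (ℝ × ℝ)) : Prop := boundingBox A ⊆ territory B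

/-- `A ↷ B`. -/
structure PounaArc (A B : Set (ℝ × ℝ)) : Prop where
  ne : A ≠ B
  inter_nonempty : (A ∩ B).Nonempty
  left_le : leftEnd B ≤ leftEnd A
  left_lt_right : leftEnd A < rightEnd B
  right_lt : rightEnd B < rightEnd A
  bottom_lt : bottomEnd B < bottomEnd A
  bottom_lt_top : bottomEnd A < topEnd A
  top_lt : topEnd A < topEnd B
  left_side_subset : {p | p ∈ A ∧ p.1 = leftEnd A} ⊆ territory B

/-- A non-empty finite family of strong Pouna sets satisfying the five constraints. -/
structure IsConstrainedFamily (F : Set (Set (ℝ × ℝ))) : Prop where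
  nonempty : F.Nonempty
  finite : F.Finite
  strongPouna : ∀ A ∈ F, IsStrongPounaSet A
  c1 : ∀ A ∈ F, ∀ B ∈ F, A ≠ B → (A ∩ B).Nonempty → PounaArc A B ∨ PounaArc B A
  c2 : ∀ A ∈ F, ∀ B ∈ F, A ∩ B = ∅ → (A ∩ territory B).Nonempty → PounaPrec A B
  c3 : ∀ A ∈ F, ∀ B ∈ F, A ≠ B → (A ∩ B).Nonempty →
    ¬ ∃ C ∈ F, C ⊆ territory A ∩ territory B
  c4 : ¬ ∃ A ∈ F, ∃ B ∈ F, ∃ C ∈ F, PounaPrec A B ∧ PounaArc A C ∧ PounaArc B C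
  c5 : ∀ K ⊆ F, K.Pairwise (fun A B => (A ∩ B).Nonempty) → K.encard ≤ 2

/-- The oriented intersection graph of a family `F`: vertex set `F`, arcs `A ↷ B`. -/
def orientedIntersectionGraph (F : Set (Set (ℝ × ℝ))) : Digraph F where
  Adj A B := PounaArc A.1 B.1

/-- An oriented constrained graph: a digraph isomorphic to the oriented intersection graph of a
non-empty finite family of strong Pouna sets satisfying the five constraints. (Such a digraph has
neither loops nor 2-cycles, because `A ↷ B` gives `rightEnd B < rightEnd A`.) -/
def IsOrientedConstrainedGraph {V : Type*} (G : Digraph V) : Prop :=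
  ∃ F : Set (Set (ℝ × ℝ)), IsConstrainedFamily F ∧
    Nonempty (G.Adj ≃r (orientedIntersectionGraph F).Adj)

/-! ### Burling sets and abstract Burling graphs -/

/-- `(S, prec, arc)` is a Burling set. In the first two axioms `y` and `z` are distinct. -/
structure IsBurlingSet {S : Type*} (prec arc : S → S → Prop) : Prop where
  nonempty : Nonempty S
  prec_irrefl : ∀ x, ¬ prec x x
  prec_trans : ∀ x y z, prec x y → prec y z → prec x z
  /-- No directed cycles (of any positive length, so in particular no loops). -/
  arc_acyclic : ∀ x, ¬ Relation.TransGen arc x x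
  a1 : ∀ x y z, prec x y → prec x z → y ≠ z → prec y z ∨ prec z y
  a2 : ∀ x y z, arc x y → arc x z → y ≠ z → prec y z ∨ prec z y
  a3 : ∀ x y z, arc x y → prec x z → prec y z
  a4 : ∀ x y z, arc x y → prec y z → arc x z ∨ prec x z

/-- An oriented abstract Burling graph: some strict partial order on the vertices makes the vertex
set, with that order and the arc relation, a Burling set. (Loops and 2-cycles are excluded by the
acyclicity of the arc relation.) -/
def IsOrientedAbstractBurlingGraph {V : Type*} (G : Digraph V) : Prop :=
  ∃ prec : V → V → Prop, IsBurlingSet prec G.Adj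

/-! ### The Burling sequence and Burling graphs -/

/-- A digraph together with a family of vertex sets. -/
structure GraphWithSets where
  V : Type
  graph : Digraph V
  sets : Set (Set V)

/-- Vertices of the graph following `X`: those of a base copy of `X`, those of one further copy of
`X` for each set `S` of `X`, and a new vertex for each pair `(S, Q)` of sets of `X`. -/
inductive NextVertex (X : GraphWithSets) : Type
  | base (x : X.V) : NextVertex X
  | copy (S : X.sets) (x : X.V) : NextVertex X
  | new (S Q : X.sets) : NextVertex X

/-- Arcs of the graph following `X`: those of all the copies, and an arc from the new vertex `(S, Q)`
to each vertex of `Q` in the copy of `X` that belongs to `S`. -/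
inductive NextArc (X : GraphWithSets) : NextVertex X → NextVertex X → Prop
  | base {x y : X.V} (h : X.graph.Adj x y) :
      NextArc X (NextVertex.base x) (NextVertex.base y)
  | copy (S : X.sets) {x y : X.V} (h : X.graph.Adj x y) :
      NextArc X (NextVertex.copy S x) (NextVertex.copy S y)
  | new (S Q : X.sets) {y : X.V} (h : y ∈ Q.1) :
      NextArc X (NextVertex.new S Q) (NextVertex.copy S y)

/-- One step of Burling's construction. For each pair `(S, Q)` of sets of `X`, the result has the two
sets "`S` in the base copy, together with `Q` in the copy belonging to `S`" and "`S` in the base copy,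
together with the new vertex `(S, Q)`". -/
def GraphWithSets.next (X : GraphWithSets) : GraphWithSets where
  V := NextVertex X
  graph := { Adj := NextArc X }
  sets := {T | ∃ S Q : X.sets,
    T = NextVertex.base '' S.1 ∪ NextVertex.copy S '' Q.1 ∨
    T = NextVertex.base '' S.1 ∪ {NextVertex.new S Q}}

/-- The Burling sequence (oriented, with its stable sets), starting from a one-vertex graph whose only
distinguished set consists of that vertex. -/
def burlingSequence : ℕ → GraphWithSets
  | 0 => { V := Unit, graph := { Adj := fun _ _ => False }, sets := {Set.univ} }
  | k + 1 => (burlingSequence k).next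

/-- An oriented Burling graph: an induced subdigraph of a digraph in the oriented Burling sequence. -/
def IsOrientedBurlingGraph {V : Type*} (G : Digraph V) : Prop :=
  ∃ k : ℕ, Nonempty (G.Adj ↪r (burlingSequence k).graph.Adj)

/-- A Burling graph: an induced subgraph of a graph in the Burling sequence. Here
`toSimpleGraphInclusive` is the underlying (non-oriented) graph of a digraph. -/
def IsBurlingGraph {V : Type*} (G : SimpleGraph V) : Prop :=
  ∃ k : ℕ, Nonempty (G ↪g (burlingSequence k).graph.toSimpleGraphInclusive)

/-!
In a constrained family, (C1) and (C2) turn contact into a relation: members that meet are joined by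
an arc, and disjoint members are comparable as soon as their territories share a point, because on
the horizontal line through that point the nearer of the two sets enters the territory of the
farther one. (C3) and (C5) make the two upper elements in (A1) and (A2) disjoint; in (A3) and (A4)
one orientation of a possible arc is excluded by (C4) and the other by comparing bounding boxes.

A finite Burling set is realized in the Burling sequence by induction, with all its upward closed
chains realized as distinguished sets. Remove a vertex `v` that is maximal for `≺` and has no
in-neighbour. Its out-neighbours form an upward closed chain among the elements not below `v`, so
one step of the construction adds `v` to a copy of the latter and makes `{v}` a distinguished set.
By (A3) and (A4) no arc joins an element below `v` to an element that is not, so the elements below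
`v` fit into the copy attached to `{v}` in the next step.
-/

theorem subset_boundingBox_of_isBounded {S : Set (ℝ × ℝ)} (hS : Bornology.IsBounded S) :
    S ⊆ boundingBox S := fun p hp =>
  have hx := hS.image_fst
  have hy := hS.image_snd
  ⟨⟨csInf_le hx.bddBelow ⟨p, hp, rfl⟩, le_csSup hx.bddAbove ⟨p, hp, rfl⟩⟩,
    csInf_le hy.bddBelow ⟨p, hp, rfl⟩, le_csSup hy.bddAbove ⟨p, hp, rfl⟩⟩

theorem rightEnd_le_of_subset_boundingBox {S T : Set (ℝ × ℝ)} (hS : S.Nonempty)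
    (h : S ⊆ boundingBox T) : rightEnd S ≤ rightEnd T :=
  csSup_le (hS.image _) (Set.forall_mem_image.2 fun _ hp => (h hp).1.2)

theorem bottomEnd_le_of_subset_boundingBox {S T : Set (ℝ × ℝ)} (hS : S.Nonempty)
    (h : S ⊆ boundingBox T) : bottomEnd T ≤ bottomEnd S :=
  le_csInf (hS.image _) (Set.forall_mem_image.2 fun _ hp => (h hp).2.1)

theorem territory_subset_boundingBox (S : Set (ℝ × ℝ)) : territory S ⊆ boundingBox S :=
  fun _ hp => hp.1.1

theorem disjoint_territory (S : Set (ℝ × ℝ)) : Disjoint S (territory S) :=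
  Set.disjoint_right.2 fun _ hp => hp.1.2

theorem mk_mem_territory_of_lt_of_lt {S : Set (ℝ × ℝ)} (hS : Bornology.IsBounded S) {p : ℝ × ℝ}
    {a b : ℝ} (hp : p ∈ territory S) (hpa : p.1 < a) (hab : a < b) (ha : (a, p.2) ∉ S)
    (hb : (b, p.2) ∈ S) : (a, p.2) ∈ territory S := by
  obtain ⟨⟨⟨hx, hy⟩, -⟩, -⟩ := hp
  have hb_le : b ≤ rightEnd S := (subset_boundingBox_of_isBounded hS hb).1.2
  exact ⟨⟨⟨⟨hx.1.trans hpa.le, hab.le.trans hb_le⟩, hy⟩, ha⟩, b, hab, hb⟩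

theorem inter_territory_nonempty_or {A B : Set (ℝ × ℝ)} (hA : Bornology.IsBounded A)
    (hB : Bornology.IsBounded B) (hAB : Disjoint A B)
    (h : (territory A ∩ territory B).Nonempty) :
    (A ∩ territory B).Nonempty ∨ (B ∩ territory A).Nonempty := by
  obtain ⟨p, hpA, hpB⟩ := h
  obtain ⟨a, hpa, ha⟩ := hpA.2
  obtain ⟨b, hpb, hb⟩ := hpB.2
  rcases lt_trichotomy a b with hab | rfl | hba
  · exact .inl ⟨_, ha, mk_mem_territory_of_lt_of_lt hB hpB hpa hab (hAB.notMem_of_mem_left ha) hb⟩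
  · exact absurd hb (hAB.notMem_of_mem_left ha)
  · exact .inr ⟨_, hb, mk_mem_territory_of_lt_of_lt hA hpA hpb hba (hAB.notMem_of_mem_right hb) ha⟩

namespace PounaPrec

variable {A B C : Set (ℝ × ℝ)}

theorem boundingBox_subset (h : PounaPrec A B) : boundingBox A ⊆ boundingBox B :=
  h.trans (territory_subset_boundingBox B)

theorem trans (hAB : PounaPrec A B) (hBC : PounaPrec B C) : PounaPrec A C :=
  hAB.boundingBox_subset.trans hBC

theorem subset_territory (hA : Bornology.IsBounded A) (h : PounaPrec A B) : A ⊆ territory B :=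
  (subset_boundingBox_of_isBounded hA).trans h

theorem irrefl (hA : Bornology.IsBounded A) (hne : A.Nonempty) : ¬ PounaPrec A A := fun h =>
  let ⟨_, hp⟩ := hne
  (disjoint_territory A).notMem_of_mem_left hp (h.subset_territory hA hp)

end PounaPrec

theorem rightEnd_lt_of_transGen_pounaArc {A B : Set (ℝ × ℝ)}
    (h : Relation.TransGen PounaArc A B) : rightEnd B < rightEnd A := by
  induction h with
  | single h => exact h.right_lt
  | tail _ h ih => exact h.right_lt.trans ih

/-- A non-empty family, finite or not, of non-empty compact plane sets with the properties
(C1)–(C5). Its members may be rectangles or disconnected, and their territories may be empty. -/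
structure IsConstrainedCompactFamily (F : Set (Set (ℝ × ℝ))) : Prop where
  nonempty : F.Nonempty
  isCompact : ∀ A ∈ F, IsCompact A
  nonempty_of_mem : ∀ A ∈ F, A.Nonempty
  c1 : ∀ A ∈ F, ∀ B ∈ F, A ≠ B → (A ∩ B).Nonempty → PounaArc A B ∨ PounaArc B A
  c2 : ∀ A ∈ F, ∀ B ∈ F, A ∩ B = ∅ → (A ∩ territory B).Nonempty → PounaPrec A B
  c3 : ∀ A ∈ F, ∀ B ∈ F, A ≠ B → (A ∩ B).Nonempty →
    ¬ ∃ C ∈ F, C ⊆ territory A ∩ territory B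
  c4 : ¬ ∃ A ∈ F, ∃ B ∈ F, ∃ C ∈ F, PounaPrec A B ∧ PounaArc A C ∧ PounaArc B C
  c5 : ∀ K ⊆ F, K.Pairwise (fun A B => (A ∩ B).Nonempty) → K.encard ≤ 2

theorem IsConstrainedFamily.isConstrainedCompactFamily {F : Set (Set (ℝ × ℝ))}
    (hF : IsConstrainedFamily F) : IsConstrainedCompactFamily F where
  nonempty := hF.nonempty
  isCompact A hA := (hF.strongPouna A hA).1.isCompact
  nonempty_of_mem A hA := (hF.strongPouna A hA).1.isPathConnected.nonempty
  c1 := hF.c1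
  c2 := hF.c2
  c3 := hF.c3
  c4 := hF.c4
  c5 := hF.c5

namespace IsConstrainedCompactFamily

variable {F : Set (Set (ℝ × ℝ))} {A B C : Set (ℝ × ℝ)}

theorem prec_or_prec_of_territory_inter_nonempty (hF : IsConstrainedCompactFamily F) (hA : A ∈ F)
    (hB : B ∈ F) (hAB : Disjoint A B) (h : (territory A ∩ territory B).Nonempty) :
    PounaPrec A B ∨ PounaPrec B A :=
  (inter_territory_nonempty_or (hF.isCompact A hA).isBounded (hF.isCompact B hB).isBounded hAB
    h).imp (hF.c2 A hA B hB hAB.inter_eq) (hF.c2 B hB A hA hAB.symm.inter_eq)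

theorem disjoint_of_common_prec (hF : IsConstrainedCompactFamily F) (hA : A ∈ F) (hB : B ∈ F)
    (hC : C ∈ F) (hAB : PounaPrec A B) (hAC : PounaPrec A C) (hne : B ≠ C) : Disjoint B C := by
  have hA_bdd := (hF.isCompact A hA).isBounded
  by_contra h
  exact hF.c3 B hB C hC hne (Set.not_disjoint_iff_nonempty_inter.1 h)
    ⟨A, hA, Set.subset_inter (hAB.subset_territory hA_bdd) (hAC.subset_territory hA_bdd)⟩

theorem prec_or_prec_of_common_prec (hF : IsConstrainedCompactFamily F) (hA : A ∈ F) (hB : B ∈ F)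
    (hC : C ∈ F) (hAB : PounaPrec A B) (hAC : PounaPrec A C) (hne : B ≠ C) :
    PounaPrec B C ∨ PounaPrec C B := by
  have hA_bdd := (hF.isCompact A hA).isBounded
  obtain ⟨p, hp⟩ := hF.nonempty_of_mem A hA
  exact hF.prec_or_prec_of_territory_inter_nonempty hB hC
    (hF.disjoint_of_common_prec hA hB hC hAB hAC hne)
    ⟨p, hAB.subset_territory hA_bdd hp, hAC.subset_territory hA_bdd hp⟩

theorem disjoint_of_common_arc (hF : IsConstrainedCompactFamily F) (hA : A ∈ F) (hB : B ∈ F)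
    (hC : C ∈ F) (hAB : PounaArc A B) (hAC : PounaArc A C) (hne : B ≠ C) : Disjoint B C := by
  by_contra h
  have hBC : (B ∩ C).Nonempty := Set.not_disjoint_iff_nonempty_inter.1 h
  have hpairwise : ({A, B, C} : Set (Set (ℝ × ℝ))).Pairwise fun A B => (A ∩ B).Nonempty := by
    have : Std.Symm fun A B : Set (ℝ × ℝ) => (A ∩ B).Nonempty :=
      ⟨fun A B h => Set.inter_comm A B ▸ h⟩
    rw [Set.pairwise_insert_of_symm, Set.pairwise_pair_of_symm]
    refine ⟨fun _ => hBC, ?_⟩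
    rintro D (rfl | rfl) _
    exacts [hAB.inter_nonempty, hAC.inter_nonempty]
  have hsub : ({A, B, C} : Set (Set (ℝ × ℝ))) ⊆ F := by
    rintro D (rfl | rfl | rfl) <;> assumption
  have hcard := hF.c5 _ hsub hpairwise
  rw [Set.encard_eq_three.2 ⟨A, B, C, hAB.ne, hAC.ne, hne, rfl⟩] at hcard
  exact absurd hcard (by decide)

theorem prec_or_prec_of_common_arc (hF : IsConstrainedCompactFamily F) (hA : A ∈ F) (hB : B ∈ F)
    (hC : C ∈ F) (hAB : PounaArc A B) (hAC : PounaArc A C) (hne : B ≠ C) :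
    PounaPrec B C ∨ PounaPrec C B := by
  obtain ⟨p, hp⟩ : ∃ p ∈ A, p.1 = leftEnd A :=
    ((hF.isCompact A hA).image continuous_fst).sInf_mem ((hF.nonempty_of_mem A hA).image _)
  exact hF.prec_or_prec_of_territory_inter_nonempty hB hC
    (hF.disjoint_of_common_arc hA hB hC hAB hAC hne)
    ⟨p, hAB.left_side_subset hp, hAC.left_side_subset hp⟩

theorem prec_of_arc_of_prec (hF : IsConstrainedCompactFamily F) (hA : A ∈ F) (hB : B ∈ F)
    (hC : C ∈ F) (hAB : PounaArc A B) (hAC : PounaPrec A C) : PounaPrec B C := by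
  have hAC_sub := hAC.subset_territory (hF.isCompact A hA).isBounded
  obtain ⟨p, hpA, hpB⟩ := hAB.inter_nonempty
  have hpC := hAC_sub hpA
  have hne : B ≠ C := fun h => (disjoint_territory C).notMem_of_mem_left (h ▸ hpB) hpC
  have not_arc_BC : ¬ PounaArc B C := fun hBC =>
    (hBC.right_lt.trans hAB.right_lt).not_ge <| rightEnd_le_of_subset_boundingBox
      (hF.nonempty_of_mem A hA) (hAC_sub.trans (territory_subset_boundingBox C))
  have not_arc_CB : ¬ PounaArc C B := fun hCB => hF.c4 ⟨A, hA, C, hC, B, hB, hAC, hAB, hCB⟩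
  refine hF.c2 B hB C hC (Set.not_nonempty_iff_eq_empty.1 fun hBC => ?_) ⟨p, hpB, hpC⟩
  exact (hF.c1 B hB C hC hne hBC).elim not_arc_BC not_arc_CB

theorem arc_or_prec_of_arc_of_prec (hF : IsConstrainedCompactFamily F) (hA : A ∈ F) (hB : B ∈ F)
    (hC : C ∈ F) (hAB : PounaArc A B) (hBC : PounaPrec B C) : PounaArc A C ∨ PounaPrec A C := by
  have hBC_sub := hBC.subset_territory (hF.isCompact B hB).isBounded
  obtain ⟨p, hpA, hpB⟩ := hAB.inter_nonempty
  have hpC := hBC_sub hpB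
  have hne : A ≠ C := fun h => (disjoint_territory C).notMem_of_mem_left (h ▸ hpA) hpC
  have not_arc_CA : ¬ PounaArc C A := fun hCA =>
    (hAB.bottom_lt.trans hCA.bottom_lt).not_ge <| bottomEnd_le_of_subset_boundingBox
      (hF.nonempty_of_mem B hB) (hBC_sub.trans (territory_subset_boundingBox C))
  rcases (A ∩ C).eq_empty_or_nonempty with hdisj | hmeet
  · exact .inr (hF.c2 A hA C hC hdisj ⟨p, hpA, hpC⟩)
  · exact .inl ((hF.c1 A hA C hC hne hmeet).resolve_right not_arc_CA)

theorem isBurlingSet (hF : IsConstrainedCompactFamily F) :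
    IsBurlingSet (fun A B : F => PounaPrec A.1 B.1) (fun A B : F => PounaArc A.1 B.1) where
  nonempty := hF.nonempty.to_subtype
  prec_irrefl A := PounaPrec.irrefl (hF.isCompact A A.2).isBounded (hF.nonempty_of_mem A A.2)
  prec_trans _ _ _ := PounaPrec.trans
  arc_acyclic _ h :=
    lt_irrefl _ (rightEnd_lt_of_transGen_pounaArc (h.lift Subtype.val fun _ _ => id))
  a1 A B C hAB hAC hne :=
    hF.prec_or_prec_of_common_prec A.2 B.2 C.2 hAB hAC (Subtype.coe_ne_coe.2 hne)
  a2 A B C hAB hAC hne :=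
    hF.prec_or_prec_of_common_arc A.2 B.2 C.2 hAB hAC (Subtype.coe_ne_coe.2 hne)
  a3 A B C := hF.prec_of_arc_of_prec A.2 B.2 C.2
  a4 A B C := hF.arc_or_prec_of_arc_of_prec A.2 B.2 C.2

end IsConstrainedCompactFamily

/-- `f` is an isomorphism from the relation `r` restricted to `A` onto the relation `s` restricted
to `f '' A`. -/
structure IsEmbeddingOn {S V : Type*} (r : S → S → Prop) (s : V → V → Prop) (f : S → V)
    (A : Set S) : Prop where
  injOn : Set.InjOn f A
  rel_iff : ∀ x ∈ A, ∀ y ∈ A, s (f x) (f y) ↔ r x y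

namespace IsEmbeddingOn

variable {S V W : Type*} {r : S → S → Prop} {s : V → V → Prop} {t : W → W → Prop}
  {f g : S → V} {A B : Set S}

theorem comp (e : s ↪r t) (hf : IsEmbeddingOn r s f A) : IsEmbeddingOn r t (e ∘ f) A where
  injOn := e.injective.comp_injOn hf.injOn
  rel_iff x hx y hy := e.map_rel_iff.trans (hf.rel_iff x hx y hy)

theorem congr (hf : IsEmbeddingOn r s f A) (hfg : Set.EqOn f g A) : IsEmbeddingOn r s g A where
  injOn := hf.injOn.congr hfg
  rel_iff x hx y hy := by rw [← hfg hx, ← hfg hy, hf.rel_iff x hx y hy]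

theorem union (hA : IsEmbeddingOn r s f A) (hB : IsEmbeddingOn r s f B) (hAB : Disjoint A B)
    (hne : ∀ x ∈ A, ∀ y ∈ B, f x ≠ f y) (hr : ∀ x ∈ A, ∀ y ∈ B, s (f x) (f y) ↔ r x y)
    (hr' : ∀ x ∈ A, ∀ y ∈ B, s (f y) (f x) ↔ r y x) : IsEmbeddingOn r s f (A ∪ B) where
  injOn := (Set.injOn_union hAB).2 ⟨hA.injOn, hB.injOn, hne⟩
  rel_iff := by
    rintro x (hx | hx) y (hy | hy)
    exacts [hA.rel_iff x hx y hy, hr x hx y hy, hr' y hy x hx, hB.rel_iff x hx y hy]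

theorem piecewise [∀ x, Decidable (x ∈ A)] (hf : IsEmbeddingOn r s f A)
    (hg : IsEmbeddingOn r s g B) (hAB : Disjoint A B) (hne : ∀ x ∈ A, ∀ y ∈ B, f x ≠ g y)
    (hr : ∀ x ∈ A, ∀ y ∈ B, s (f x) (g y) ↔ r x y)
    (hr' : ∀ x ∈ A, ∀ y ∈ B, s (g y) (f x) ↔ r y x) :
    IsEmbeddingOn r s (A.piecewise f g) (A ∪ B) := by
  have hA : Set.EqOn (A.piecewise f g) f A := Set.piecewise_eqOn A f g
  have hB : Set.EqOn (A.piecewise f g) g B :=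
    (Set.piecewise_eqOn_compl A f g).mono hAB.subset_compl_left
  refine (hf.congr hA.symm).union (hg.congr hB.symm) hAB ?_ ?_ ?_ <;> intro x hx y hy <;>
    rw [hA hx, hB hy]
  exacts [hne x hx y hy, hr x hx y hy, hr' x hx y hy]

end IsEmbeddingOn

theorem union_inter_piecewise_preimage {S V : Type*} {A B : Set S} [∀ x, Decidable (x ∈ A)]
    (hAB : Disjoint A B) (f g : S → V) (T : Set V) :
    (A ∪ B) ∩ A.piecewise f g ⁻¹' T = (A ∩ f ⁻¹' T) ∪ (B ∩ g ⁻¹' T) := by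
  rw [Set.union_inter_distrib_right]
  congr 1 <;> ext x <;> refine and_congr_right fun hx => ?_
  · rw [Set.mem_preimage, Set.piecewise_eq_of_mem _ _ _ hx, Set.mem_preimage]
  · rw [Set.mem_preimage, Set.piecewise_eq_of_notMem _ _ _ (hAB.notMem_of_mem_right hx),
      Set.mem_preimage]

namespace GraphWithSets

/-- The base copy of `X` as an induced subdigraph of the digraph following `X`. -/
def baseEmbedding (X : GraphWithSets) : X.graph.Adj ↪r X.next.graph.Adj where
  toFun := NextVertex.base
  inj' _ _ := NextVertex.base.inj
  map_rel_iff' := ⟨fun h => by cases h; assumption, NextArc.base⟩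

/-- The copy of `X` belonging to `P` as an induced subdigraph of the digraph following `X`. -/
def copyEmbedding (X : GraphWithSets) (P : X.sets) : X.graph.Adj ↪r X.next.graph.Adj where
  toFun := NextVertex.copy P
  inj' _ _ h := (NextVertex.copy.inj h).2
  map_rel_iff' := ⟨fun h => by cases h; assumption, NextArc.copy P⟩

/-- The distinguished set `P ∪ Q^P` of the graph following `X`, with `P` taken in the base copy. -/
def unionCopy (X : GraphWithSets) (P Q : X.sets) : Set X.next.V :=
  NextVertex.base '' P.1 ∪ NextVertex.copy P '' Q.1

/-- The distinguished set `P ∪ {v_{P,Q}}` of the graph following `X`, with `P` taken in the base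
copy. -/
def unionNew (X : GraphWithSets) (P Q : X.sets) : Set X.next.V :=
  NextVertex.base '' P.1 ∪ {NextVertex.new P Q}

section next

variable {X : GraphWithSets} (P Q R R' : X.sets)

theorem unionCopy_mem_sets_next : X.unionCopy P Q ∈ X.next.sets := ⟨P, Q, .inl rfl⟩

theorem unionNew_mem_sets_next : X.unionNew P Q ∈ X.next.sets := ⟨P, Q, .inr rfl⟩

theorem baseEmbedding_preimage_unionCopy : X.baseEmbedding ⁻¹' X.unionCopy P Q = P := by
  ext x
  change .base x ∈ NextVertex.base '' P.1 ∪ NextVertex.copy P '' Q.1 ↔ x ∈ P.1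
  simp

theorem copyEmbedding_preimage_unionCopy : X.copyEmbedding P ⁻¹' X.unionCopy P Q = Q := by
  ext x
  change .copy P x ∈ NextVertex.base '' P.1 ∪ NextVertex.copy P '' Q.1 ↔ x ∈ Q.1
  simp

theorem new_notMem_unionCopy : .new R R' ∉ X.unionCopy P Q := by
  rintro (⟨_, _, h⟩ | ⟨_, _, h⟩) <;> cases h

theorem baseEmbedding_preimage_unionNew : X.baseEmbedding ⁻¹' X.unionNew P Q = P := by
  ext x
  change .base x ∈ NextVertex.base '' P.1 ∪ {NextVertex.new P Q} ↔ x ∈ P.1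
  simp

theorem copyEmbedding_preimage_unionNew : X.copyEmbedding R ⁻¹' X.unionNew P Q = ∅ := by
  ext x
  change .copy R x ∈ NextVertex.base '' P.1 ∪ {NextVertex.new P Q} ↔ False
  simp

theorem new_mem_unionNew : .new P Q ∈ X.unionNew P Q := .inr rfl

end next

/-- `X` contains an induced copy of the digraph `arc` on `A` in which every set of `𝒯` is the trace
of one of the sets of `X`. In particular the sets of `𝒯` are subsets of `A`. -/
def Realizes {S : Type*} (X : GraphWithSets) (arc : S → S → Prop) (A : Set S)
    (𝒯 : Set (Set S)) : Prop :=
  ∃ f : S → X.V, IsEmbeddingOn arc X.graph.Adj f A ∧ ∀ T ∈ 𝒯, ∃ T' ∈ X.sets, A ∩ f ⁻¹' T' = T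

namespace Realizes

variable {S : Type*} {X : GraphWithSets} {arc : S → S → Prop} {A D : Set S} {𝒯 𝒟 : Set (Set S)}

theorem mono (h : X.Realizes arc A 𝒯) (h𝒟 : 𝒟 ⊆ 𝒯) : X.Realizes arc A 𝒟 :=
  let ⟨f, hf, htrace⟩ := h
  ⟨f, hf, fun T hT => htrace T (h𝒟 hT)⟩

theorem next (h : X.Realizes arc A 𝒯) : X.next.Realizes arc A 𝒯 := by
  obtain ⟨f, hf, htrace⟩ := h
  refine ⟨X.baseEmbedding ∘ f, hf.comp X.baseEmbedding, fun T hT => ?_⟩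
  obtain ⟨T', hT', rfl⟩ := htrace T hT
  refine ⟨_, unionNew_mem_sets_next ⟨T', hT'⟩ ⟨T', hT'⟩, ?_⟩
  rw [Set.preimage_comp, baseEmbedding_preimage_unionNew]

theorem burlingSequence_le {k l : ℕ} (h : (burlingSequence k).Realizes arc A 𝒯) (hkl : k ≤ l) :
    (burlingSequence l).Realizes arc A 𝒯 := by
  induction hkl with
  | refl => exact h
  | step _ ih => exact ih.next

/-- `A` goes to a copy of `X`, and `v` to a new vertex attached to it. -/
theorem next_insert (h : X.Realizes arc A 𝒯) {v : S} (hv : v ∉ A)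
    (hout : {x ∈ A | arc v x} ∈ 𝒯) (hin : ∀ x ∈ insert v A, ¬ arc x v) :
    X.next.Realizes arc (insert v A) (insert {v} 𝒯) := by
  classical
  obtain ⟨f, hf, htrace⟩ := h
  obtain ⟨N', hN', hN⟩ := htrace _ hout
  have hN_iff : ∀ x ∈ A, f x ∈ N' ↔ arc v x := fun x hx => by
    simpa [hx] using Set.ext_iff.1 hN x
  let P : X.sets := ⟨N', hN'⟩
  let g : S → X.next.V := fun _ => .new P P
  have hdisj : Disjoint A {v} := Set.disjoint_singleton_right.2 hv
  have hg : IsEmbeddingOn arc X.next.graph.Adj g {v} :=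
    ⟨Set.injOn_singleton g v, by
      rintro x rfl y rfl
      exact iff_of_false nofun (hin _ (Set.mem_insert _ _))⟩
  rw [← Set.union_singleton]
  refine ⟨_, (hf.comp (X.copyEmbedding P)).piecewise hg hdisj ?_ ?_ ?_, ?_⟩
  · exact fun _ _ _ _ => nofun
  · rintro x hx y rfl
    exact iff_of_false nofun (hin x (.inr hx))
  · rintro x hx y rfl
    rw [← hN_iff x hx]
    exact ⟨fun h => by cases h; assumption, NextArc.new P P⟩
  · rintro T (rfl | hT)
    · refine ⟨_, unionNew_mem_sets_next P P, ?_⟩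
      rw [union_inter_piecewise_preimage hdisj, Set.preimage_comp, copyEmbedding_preimage_unionNew,
        Set.preimage_const_of_mem (new_mem_unionNew P P), Set.preimage_empty, Set.inter_empty,
        Set.empty_union, Set.inter_univ]
    · obtain ⟨T', hT', rfl⟩ := htrace T hT
      refine ⟨_, unionCopy_mem_sets_next P ⟨T', hT'⟩, ?_⟩
      rw [union_inter_piecewise_preimage hdisj, Set.preimage_comp, copyEmbedding_preimage_unionCopy,
        Set.preimage_const_of_notMem (new_notMem_unionCopy P _ P P), Set.inter_empty,
        Set.union_empty]

/-- `A` goes to the base copy of `X`, and `D` to the copy attached to `P`. -/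
theorem next_union (hA : X.Realizes arc A 𝒯) (hD : X.Realizes arc D 𝒟) (hAD : Disjoint A D)
    (harc : ∀ x ∈ A, ∀ y ∈ D, ¬ arc x y ∧ ¬ arc y x) {P : Set S} (hP : P ∈ 𝒯) :
    X.next.Realizes arc (A ∪ D) (𝒯 ∪ (P ∪ ·) '' 𝒟) := by
  classical
  obtain ⟨f, hf, hf_trace⟩ := hA
  obtain ⟨g, hg, hg_trace⟩ := hD
  obtain ⟨P', hP', rfl⟩ := hf_trace P hP
  let Q : X.sets := ⟨P', hP'⟩
  refine ⟨_, (hf.comp X.baseEmbedding).piecewise (hg.comp (X.copyEmbedding Q)) hAD ?_ ?_ ?_, ?_⟩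
  · exact fun _ _ _ _ => nofun
  · exact fun x hx y hy => iff_of_false nofun (harc x hx y hy).1
  · exact fun x hx y hy => iff_of_false nofun (harc x hx y hy).2
  · rintro _ (hT | ⟨T, hT, rfl⟩)
    · obtain ⟨T', hT', rfl⟩ := hf_trace _ hT
      refine ⟨_, unionNew_mem_sets_next ⟨T', hT'⟩ ⟨T', hT'⟩, ?_⟩
      rw [union_inter_piecewise_preimage hAD, Set.preimage_comp, Set.preimage_comp,
        baseEmbedding_preimage_unionNew, copyEmbedding_preimage_unionNew, Set.preimage_empty,
        Set.inter_empty, Set.union_empty]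
    · obtain ⟨T', hT', rfl⟩ := hg_trace T hT
      refine ⟨_, unionCopy_mem_sets_next Q ⟨T', hT'⟩, ?_⟩
      rw [union_inter_piecewise_preimage hAD, Set.preimage_comp, Set.preimage_comp,
        baseEmbedding_preimage_unionCopy, copyEmbedding_preimage_unionCopy]

end Realizes

end GraphWithSets

/-- The chains of `prec` contained in `A` and upward closed in `A`. -/
def upperChains {S : Type*} (prec : S → S → Prop) (A : Set S) : Set (Set S) :=
  {T | T ⊆ A ∧ IsChain prec T ∧ ∀ x ∈ T, ∀ y ∈ A, prec x y → y ∈ T}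

section upperChains

variable {S : Type*} {prec : S → S → Prop} {A B T : Set S} {v : S}

theorem inter_mem_upperChains (hT : T ∈ upperChains prec A) (B : Set S) :
    T ∩ B ∈ upperChains prec (A ∩ B) :=
  ⟨Set.inter_subset_inter_left B hT.1, hT.2.1.mono Set.inter_subset_left,
    fun x hx y hy hxy => ⟨hT.2.2 x hx.1 y hy.1 hxy, hy.2⟩⟩

theorem mem_upperChains_of_subset (hT : T ∈ upperChains prec A) (hTB : T ⊆ B) (hBA : B ⊆ A) :
    T ∈ upperChains prec B :=
  ⟨hTB, hT.2.1, fun x hx y hy => hT.2.2 x hx y (hBA hy)⟩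

theorem upperChains_subset_of_maximal (hv : v ∈ A) (hmax : ∀ x ∈ A, ¬ prec v x) :
    upperChains prec A ⊆ insert {v} (upperChains prec ((A \ {x | prec x v}) \ {v})) ∪
      ({v} ∪ ·) '' upperChains prec (A ∩ {x | prec x v}) := by
  intro T hT
  obtain ⟨hTA, hchain, hup⟩ := hT
  by_cases hvT : v ∈ T
  · refine .inr ⟨_, inter_mem_upperChains ⟨hTA, hchain, hup⟩ {x | prec x v}, ?_⟩
    refine Set.Subset.antisymm
      (Set.union_subset (Set.singleton_subset_iff.2 hvT) Set.inter_subset_left) fun x hx => ?_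
    refine or_iff_not_imp_left.2 fun hne => ⟨hx, ?_⟩
    exact (hchain hx hvT hne).resolve_right (hmax x (hTA hx))
  · refine .inl (.inr (mem_upperChains_of_subset ⟨hTA, hchain, hup⟩ (fun x hx => ?_)
      (Set.sdiff_subset.trans Set.sdiff_subset)))
    exact ⟨⟨hTA hx, fun hxv => hvT (hup x hx v hv hxv)⟩, ne_of_mem_of_not_mem hx hvT⟩

end upperChains

theorem exists_mem_forall_not_rel {S : Type*} (r : S → S → Prop) [IsStrictOrder S r] {A : Set S}
    (hA : A.Finite) (hne : A.Nonempty) : ∃ v ∈ A, ∀ x ∈ A, ¬ r x v := by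
  obtain ⟨v, hv, hmin⟩ :=
    (Set.wellFoundedOn_iff.1 (hA.wellFoundedOn (r := r))).has_min A hne
  exact ⟨v, hv, fun x hx hxv => hmin x hx ⟨hxv, hx, hv⟩⟩

namespace IsBurlingSet

variable {S : Type*} {prec arc : S → S → Prop} {A : Set S} {v x y : S}

theorem comap {V : Type*} [Nonempty V] {arc' : V → V → Prop} (h : IsBurlingSet prec arc)
    (e : arc' ↪r arc) : IsBurlingSet (fun x y => prec (e x) (e y)) arc' where
  nonempty := inferInstance
  prec_irrefl _ := h.prec_irrefl _
  prec_trans _ _ _ := h.prec_trans _ _ _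
  arc_acyclic x hx := h.arc_acyclic (e x) (hx.lift e fun _ _ => e.map_rel_iff.2)
  a1 _ _ _ hxy hxz hne := h.a1 _ _ _ hxy hxz (e.injective.ne hne)
  a2 _ _ _ hxy hxz hne :=
    h.a2 _ _ _ (e.map_rel_iff.2 hxy) (e.map_rel_iff.2 hxz) (e.injective.ne hne)
  a3 _ _ _ hxy := h.a3 _ _ _ (e.map_rel_iff.2 hxy)
  a4 _ _ _ hxy hyz := (h.a4 _ _ _ (e.map_rel_iff.2 hxy) hyz).imp_left e.map_rel_iff.1

theorem exists_maximal_source (h : IsBurlingSet prec arc) (hA : A.Finite) (hne : A.Nonempty) :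
    ∃ v ∈ A, (∀ x ∈ A, ¬ prec v x) ∧ ∀ x ∈ A, ¬ arc x v := by
  have : IsStrictOrder S (flip prec) :=
    { irrefl := h.prec_irrefl, trans := fun x y z hxy hyz => h.prec_trans z y x hyz hxy }
  have : IsStrictOrder S (Relation.TransGen arc) :=
    { irrefl := h.arc_acyclic, trans := fun _ _ _ => .trans }
  obtain ⟨m, hmA, hm⟩ := exists_mem_forall_not_rel (flip prec) hA hne
  obtain ⟨v, ⟨hvA, hmax⟩, hsource⟩ := exists_mem_forall_not_rel (Relation.TransGen arc)
    (hA.subset (Set.sep_subset A fun x => ∀ y ∈ A, ¬ prec x y)) ⟨m, hmA, hm⟩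
  -- by (A3), an in-neighbour of a maximal element is maximal
  exact ⟨v, hvA, hmax, fun x hx hxv => hsource x
    ⟨hx, fun y hy hxy => hmax y hy (h.a3 x v y hxv hxy)⟩ (.single hxv)⟩

theorem outNeighbors_mem_upperChains (h : IsBurlingSet prec arc) (hmax : ∀ x ∈ A, ¬ prec v x) :
    {x ∈ (A \ {x | prec x v}) \ {v} | arc v x} ∈
      upperChains prec ((A \ {x | prec x v}) \ {v}) :=
  ⟨Set.sep_subset _ _, fun x hx y hy => h.a2 v x y hx.2 hy.2,
    fun x hx y hy hxy => ⟨hy, (h.a4 v x y hx.2 hxy).resolve_right (hmax y hy.1.1)⟩⟩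

theorem not_arc_and_not_arc_of_prec (h : IsBurlingSet prec arc) (hyv : prec y v)
    (hxv : ¬ prec x v) (hsource : ¬ arc x v) : ¬ arc x y ∧ ¬ arc y x :=
  ⟨fun hxy => (h.a4 x y v hxy hyv).elim hsource hxv, fun hyx => hxv (h.a3 y x v hyx hyv)⟩

theorem realizes_next_next (h : IsBurlingSet prec arc) {X : GraphWithSets} (hv : v ∈ A)
    (hmax : ∀ x ∈ A, ¬ prec v x) (hsource : ∀ x ∈ A, ¬ arc x v)
    (hbelow : X.Realizes arc (A ∩ {x | prec x v}) (upperChains prec (A ∩ {x | prec x v})))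
    (hbeside : X.Realizes arc ((A \ {x | prec x v}) \ {v})
      (upperChains prec ((A \ {x | prec x v}) \ {v}))) :
    X.next.next.Realizes arc A (upperChains prec A) := by
  have hv_mem : v ∈ A \ {x | prec x v} := ⟨hv, h.prec_irrefl v⟩
  have hinsert := hbeside.next_insert (Set.notMem_sdiff_of_mem rfl)
    (h.outNeighbors_mem_upperChains hmax)
  rw [Set.insert_sdiff_singleton, Set.insert_eq_of_mem hv_mem] at hinsert
  have hunion := (hinsert fun x hx => hsource x hx.1).next_union hbelow.next
    Set.disjoint_sdiff_inter
    (fun x hx y hy => h.not_arc_and_not_arc_of_prec hy.2 hx.2 (hsource x hx.1))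
    (Set.mem_insert {v} _)
  rw [Set.sdiff_union_inter] at hunion
  exact hunion.mono (upperChains_subset_of_maximal hv hmax)

theorem exists_realizes_upperChains (h : IsBurlingSet prec arc) (hA : A.Finite) :
    ∃ k, (burlingSequence k).Realizes arc A (upperChains prec A) := by
  induction hn : A.ncard using Nat.strong_induction_on generalizing A with
  | _ n ih =>
  subst hn
  rcases A.eq_empty_or_nonempty with rfl | hne
  · refine ⟨0, fun _ => (), ⟨Set.injOn_empty _, nofun⟩, fun T hT => ⟨Set.univ, rfl, ?_⟩⟩
    rw [Set.subset_empty_iff.1 hT.1, Set.empty_inter]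
  obtain ⟨v, hvA, hmax, hsource⟩ := h.exists_maximal_source hA hne
  have ih_of_subset : ∀ B ⊆ A, v ∉ B → ∃ k, (burlingSequence k).Realizes arc B
      (upperChains prec B) := fun B hBA hvB =>
    ih _ (Set.ncard_lt_ncard ⟨hBA, fun hAB => hvB (hAB hvA)⟩ hA) (hA.subset hBA) rfl
  obtain ⟨k, hk⟩ := ih_of_subset (A ∩ {x | prec x v}) Set.inter_subset_left
    fun hv => h.prec_irrefl v hv.2
  obtain ⟨l, hl⟩ := ih_of_subset ((A \ {x | prec x v}) \ {v})
    (Set.sdiff_subset.trans Set.sdiff_subset) fun hv => hv.2 rfl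
  exact ⟨max k l + 2, h.realizes_next_next hvA hmax hsource
    (hk.burlingSequence_le (le_max_left k l)) (hl.burlingSequence_le (le_max_right k l))⟩

end IsBurlingSet

theorem IsOrientedAbstractBurlingGraph.isOrientedBurlingGraph {V : Type*} [Finite V]
    {G : Digraph V} (hG : IsOrientedAbstractBurlingGraph G) : IsOrientedBurlingGraph G := by
  obtain ⟨prec, h⟩ := hG
  obtain ⟨k, f, hf, -⟩ := h.exists_realizes_upperChains Set.finite_univ
  exact ⟨k, ⟨⟨f, Set.injOn_univ.1 hf.injOn⟩, hf.rel_iff _ trivial _ trivial⟩⟩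

theorem IsOrientedBurlingGraph.isBurlingGraph {V : Type*} {G : Digraph V}
    (hG : IsOrientedBurlingGraph G) : IsBurlingGraph G.toSimpleGraphInclusive := by
  obtain ⟨k, ⟨f⟩⟩ := hG
  refine ⟨k, ⟨⟨f.toEmbedding, ?_⟩⟩⟩
  simp [Digraph.toSimpleGraphInclusive, f.map_rel_iff]

theorem theorem4p4_general :
    (∀ F : Set (Set (ℝ × ℝ)), IsConstrainedCompactFamily F →
      IsBurlingSet (fun A B : F => PounaPrec A.1 B.1) (fun A B : F => PounaArc A.1 B.1)) ∧
    (∀ F : Set (Set (ℝ × ℝ)), IsConstrainedCompactFamily F →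
      ∀ (V : Type*) [Nonempty V] (G : Digraph V),
        (G.Adj ↪r (orientedIntersectionGraph F).Adj) →
        IsOrientedAbstractBurlingGraph G ∧
          (Finite V → IsOrientedBurlingGraph G ∧ IsBurlingGraph G.toSimpleGraphInclusive)) := by
  refine ⟨fun F hF => hF.isBurlingSet, fun F hF V _ G e => ?_⟩
  have hG : IsOrientedAbstractBurlingGraph G := ⟨_, hF.isBurlingSet.comap e⟩
  exact ⟨hG, fun _ => ⟨hG.isOrientedBurlingGraph, hG.isOrientedBurlingGraph.isBurlingGraph⟩⟩

theorem theorem4p4 :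
    (∀ F : Set (Set (ℝ × ℝ)), IsConstrainedFamily F →
      IsBurlingSet (fun A B : F => PounaPrec A.1 B.1) (fun A B : F => PounaArc A.1 B.1)) ∧
    (∀ (V : Type*) (G : Digraph V), IsOrientedConstrainedGraph G →
      IsOrientedAbstractBurlingGraph G ∧ IsOrientedBurlingGraph G ∧
        IsBurlingGraph G.toSimpleGraphInclusive) := by
  refine theorem4p4_general.imp (fun h F hF => h F hF.isConstrainedCompactFamily) ?_
  rintro h V G ⟨F, hF, ⟨e⟩⟩
  have : Finite F := hF.finite
  have : Nonempty V := hF.nonempty.to_subtype.map e.symm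
  have hG := h F hF.isConstrainedCompactFamily V G e.toRelEmbedding
  exact ⟨hG.1, hG.2 (.of_injective e e.injective)⟩
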